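/- Let $n,m\ge 0$ be integers. For a complex matrix (or column vector) $M$, let $M'$ denote its conjugate transpose. Let $A\in\mathbb{C}^{n\times n}$ and $B\in\mathbb{C}^{n\times m}$ be such that the pair $(A,B)$ is controllable, i.e. the $n\times(n+m)$ matrix $[\lambda I_n-A,\ B]$ is right invertible for every $\lambda\in\mathbb{C}$. Let $Q=Q'\in\mathbb{C}^{(n+m)\times(n+m)}$, and let $\sigma:\mathbb{C}^n\times\mathbb{C}^m\to\mathbb{R}$ be the Hermitian form $$\sigma(x,u)=\begin{bmatrix}x\\u\end{bmatrix}'Q\begin{bmatrix}x\\u\end{bmatrix}.$$ Then the following conditions are equivalent: (a) there exists a matrix $P=P'\in\mathbb{C}^{n\times n}$ such that the Hermitian form $\sigma_P(x,u)=\sigma(x,u)+2\,\mathrm{Re}[x'P(Ax+Bu)]$ is positive semidefinite, i.e. $\sigma_P(x,u)\ge0$ for all $x\in\mathbb{C}^n$, $u\in\mathbb{C}^m$; (b) for every $s\in\mathbb{C}$ with $\mathrm{Re}(s)=0$, the form $\sigma$ is positive semidefinite on the subspace $\mathcal{L}(s)=\{(x,u)\in\mathbb{C}^n\times\mathbb{C}^m:\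 sx=Ax+Bu\}$, i.e. $\sigma(x,u)\ge0$ for all $(x,u)\in\mathcal{L}(s)$. Moreover, if $A,B,Q$ have real entries and (b) holds, then the matrix $P$ in (a) can be chosen with real entries. -/

import Mathlib

open scoped Matrix

namespace KYP

/-- The pair `(A, B)` is controllable: `[λ I - A, B]` is right invertible for every complex `λ`. -/
def Controllable {n m : ℕ} (A : Matrix (Fin n) (Fin n) ℂ) (B : Matrix (Fin n) (Fin m) ℂ) : Prop :=
  ∀ l : ℂ, ∃ R : Matrix (Fin n ⊕ Fin m) (Fin n) ℂ,
    Matrix.fromCols (l • (1 : Matrix (Fin n) (Fin n) ℂ) - A) B * R = 1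

/-- The form `σ(x, u) = [x; u]' Q [x; u]`. For Hermitian `Q` the complex number on the right is
real, so that taking its real part only changes its type. -/
def sigma {n m : ℕ} (Q : Matrix (Fin n ⊕ Fin m) (Fin n ⊕ Fin m) ℂ)
    (v : (Fin n → ℂ) × (Fin m → ℂ)) : ℝ :=
  (star (Sum.elim v.1 v.2) ⬝ᵥ (Q *ᵥ Sum.elim v.1 v.2)).re

/-- The justification of the real part in `sigma`: the value is indeed real. -/
theorem sigma_ofReal {n m : ℕ} {Q : Matrix (Fin n ⊕ Fin m) (Fin n ⊕ Fin m) ℂ}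
    (hQ : Q.IsHermitian) (v : (Fin n → ℂ) × (Fin m → ℂ)) :
    ((sigma Q v : ℝ) : ℂ) = star (Sum.elim v.1 v.2) ⬝ᵥ (Q *ᵥ Sum.elim v.1 v.2) :=
  Complex.ext rfl (hQ.im_star_dotProduct_mulVec_self _).symm

/-- The form `σ_P(x, u) = σ(x, u) + 2 Re[x' P (A x + B u)]`. -/
def sigmaP {n m : ℕ} (A : Matrix (Fin n) (Fin n) ℂ) (B : Matrix (Fin n) (Fin m) ℂ)
    (Q : Matrix (Fin n ⊕ Fin m) (Fin n ⊕ Fin m) ℂ) (P : Matrix (Fin n) (Fin n) ℂ)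
    (v : (Fin n → ℂ) × (Fin m → ℂ)) : ℝ :=
  sigma Q v + 2 * (star v.1 ⬝ᵥ (P *ᵥ (A *ᵥ v.1 + B *ᵥ v.2))).re

/-- The subspace `L(s) = {(x, u) : s x = A x + B u}`. -/
def L {n m : ℕ} (A : Matrix (Fin n) (Fin n) ℂ) (B : Matrix (Fin n) (Fin m) ℂ) (s : ℂ) :
    Submodule ℂ ((Fin n → ℂ) × (Fin m → ℂ)) where
  carrier := {v | s • v.1 = A *ᵥ v.1 + B *ᵥ v.2}
  zero_mem' := by simp
  add_mem' := by
    intro v w hv hw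
    simp only [Set.mem_ofPred_eq, Prod.fst_add, Prod.snd_add, smul_add, Matrix.mulVec_add] at *
    rw [hv, hw]
    abel
  smul_mem' := by
    intro c v hv
    simp only [Set.mem_ofPred_eq, Prod.smul_fst, Prod.smul_snd, Matrix.mulVec_smul] at *
    rw [smul_comm, hv, smul_add]

/-- A (Hermitian) form is positive semidefinite on a subspace. -/
def PosSemidefOn {V : Type*} [AddCommGroup V] [Module ℂ V] (f : V → ℝ) (S : Submodule ℂ V) :
    Prop :=
  ∀ v ∈ S, 0 ≤ f v

/-- All entries of a complex matrix are real. -/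
def IsRealMatrix {p q : Type*} (M : Matrix p q ℂ) : Prop :=
  ∀ i j, (M i j).im = 0

end KYP

/-! From (a) to (b): on `L(s)` with `Re s = 0` the added term is `2 Re (s x'Px) = 0`, since `x'Px`
is real.

From (b) to (a), by duality. The pairs `(M, P)` with `P` Hermitian and the form of `M` plus the
`P`-term nonnegative make up a closed convex cone. Controllability forces `P = 0` when `M = 0`, so
the projection to `M` is closed. If no `P` serves `Q`, a functional `f` separates `Q` from this
projection. It is nonnegative on positive forms, so `f M = Re tr (T' M T)`. It vanishes on the
`P`-terms, so the blocks `X`, `U` of `T` satisfy `X Y' + Y X' = 0` with `Y = A X + B U`.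

Then `(X + Y)(X + Y)' = (X - Y)(X - Y)'`, so some isometry `W` satisfies `W (X - Y)' = (X + Y)'`. In
an orthonormal eigenbasis `b i` of `W`, each pair `(X b i, U b i)` lies in some `L(s)` with `Re s =
0`, or has `X b i = 0`, the limit case `s → ∞`. Hence `f Q` is a sum of nonnegative values of `σ`,
contradicting `f Q < 0`. -/

/-! ### Isometries and the factorization behind `X Y' + Y X' = 0`. -/

theorem LinearIsometry.inner_eq_zero_of_eigenvectors {E : Type*} [NormedAddCommGroup E]
    [InnerProductSpace ℂ E] (W : E →ₗᵢ[ℂ] E) {μ ν : ℂ} (hμν : μ ≠ ν) {v w : E}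
    (hv : W v = μ • v) (hw : W w = ν • w) : inner ℂ v w = 0 := by
  by_contra h
  have hv0 : v ≠ 0 := by rintro rfl; simp at h
  have h1 := W.inner_map_map v w
  have h2 := W.inner_map_map v v
  rw [hv, hw, inner_smul_left, inner_smul_right, ← mul_assoc] at h1
  rw [hv, inner_smul_left, inner_smul_right, ← mul_assoc] at h2
  have h3 := mul_eq_right₀ h |>.1 h1
  have h4 := mul_eq_right₀ (inner_self_ne_zero.2 hv0) |>.1 h2
  have h5 : (starRingEnd ℂ) μ ≠ 0 := left_ne_zero_of_mul_eq_one h4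
  exact hμν (mul_left_cancel₀ h5 (h4.trans h3.symm))

theorem LinearIsometry.norm_eigenvalue {E : Type*} [NormedAddCommGroup E]
    [InnerProductSpace ℂ E] (W : E →ₗᵢ[ℂ] E) {μ : ℂ} {v : E} (hv0 : v ≠ 0)
    (hv : W v = μ • v) : ‖μ‖ = 1 := by
  have h := W.norm_map v
  rw [hv, norm_smul] at h
  exact (mul_eq_right₀ (norm_ne_zero_iff.2 hv0)).1 h

theorem LinearIsometry.exists_orthonormalBasis_eigenvectors {E : Type*} [NormedAddCommGroup E]
    [InnerProductSpace ℂ E] [FiniteDimensional ℂ E] (W : E →ₗᵢ[ℂ] E) :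
    ∃ (b : OrthonormalBasis (Fin (Module.finrank ℂ E)) ℂ E)
      (μ : Fin (Module.finrank ℂ E) → ℂ), ∀ i, W (b i) = μ i • b i := by
  classical
  set T : Module.End ℂ E := W.toLinearMap with hT
  have horth : OrthogonalFamily ℂ (fun μ : T.Eigenvalues => T.eigenspace μ)
      fun μ => (T.eigenspace μ).subtypeₗᵢ := by
    rintro μ ν hμν ⟨v, hv⟩ ⟨w, hw⟩
    rw [Module.End.mem_eigenspace_iff] at hv hw
    exact W.inner_eq_zero_of_eigenvectors (fun h => hμν (Subtype.ext h)) hv hw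
  have hinv : ∀ v ∈ (⨆ μ, T.eigenspace μ)ᗮ, T v ∈ (⨆ μ, T.eigenspace μ)ᗮ := by
    intro v hv
    rw [← Submodule.iInf_orthogonal] at hv ⊢
    refine T.iInf_invariant (fun μ v hv w hw => ?_) v hv
    have hw' := hw
    rw [Module.End.mem_eigenspace_iff] at hw'
    rcases eq_or_ne w 0 with rfl | hw0
    · simp
    have hμ : μ ≠ 0 := by
      rintro rfl
      have := W.norm_eigenvalue hw0 hw'
      simp at this
    have h1 : inner ℂ (T w) (T v) = 0 := (W.inner_map_map w v).trans (hv w hw)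
    rw [hw', inner_smul_left] at h1
    exact (mul_eq_zero.1 h1).resolve_left (by simpa using hμ)
  have hbot : (⨆ μ, T.eigenspace μ)ᗮ = ⊥ := by
    by_contra hne
    have : Nontrivial ↥(⨆ μ, T.eigenspace μ)ᗮ := Submodule.nontrivial_iff_ne_bot.2 hne
    obtain ⟨μ, hμ⟩ := Module.End.exists_eigenvalue (T.restrict hinv)
    obtain ⟨v, hv, hv0⟩ := hμ.exists_hasEigenvector
    rw [Module.End.mem_eigenspace_iff] at hv
    have hv' : (v : E) ∈ T.eigenspace μ := by
      rw [Module.End.mem_eigenspace_iff]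
      exact congrArg Subtype.val hv
    have h0 := v.2 v (Submodule.mem_iSup_of_mem μ hv')
    exact hv0 (Subtype.ext (inner_self_eq_zero.1 h0))
  have hint : DirectSum.IsInternal fun μ : T.Eigenvalues => T.eigenspace μ := by
    refine horth.isInternal_iff.2 ?_
    rw [← hbot]
    congr 1
    exact iSup_ne_bot_subtype _
  exact ⟨hint.subordinateOrthonormalBasis rfl horth,
    fun i => (hint.subordinateOrthonormalBasisIndex rfl i horth : T.Eigenvalues), fun i =>
    Module.End.mem_eigenspace_iff.1 (hint.subordinateOrthonormalBasis_subordinate rfl i horth)⟩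

theorem LinearMap.exists_linearIsometry_comp_eq {H E : Type*} [NormedAddCommGroup H]
    [InnerProductSpace ℂ H] [NormedAddCommGroup E] [InnerProductSpace ℂ E]
    [FiniteDimensional ℂ E] (f g : H →ₗ[ℂ] E) (h : ∀ v, ‖f v‖ = ‖g v‖) :
    ∃ W : E →ₗᵢ[ℂ] E, ∀ v, W (g v) = f v := by
  have hker : LinearMap.ker g ≤ LinearMap.ker f := by
    intro v hv
    rw [LinearMap.mem_ker] at hv ⊢
    rw [← norm_eq_zero, h, hv, norm_zero]
  let L₀ : LinearMap.range g →ₗ[ℂ] E :=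
    ((LinearMap.ker g).liftQ f hker).comp g.quotKerEquivRange.symm.toLinearMap
  have hL₀ : ∀ v, L₀ ⟨g v, LinearMap.mem_range_self g v⟩ = f v := by
    intro v
    have : g.quotKerEquivRange.symm ⟨g v, LinearMap.mem_range_self g v⟩ =
        (LinearMap.ker g).mkQ v := g.quotKerEquivRange_symm_apply_image v _
    simp [L₀, this]
  let L : LinearMap.range g →ₗᵢ[ℂ] E := ⟨L₀, by rintro ⟨_, v, rfl⟩; rw [hL₀, h]; rfl⟩
  exact ⟨L.extend, fun v => (L.extend_apply ⟨g v, LinearMap.mem_range_self g v⟩).trans (hL₀ v)⟩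

theorem Complex.re_sub_one_div_add_one {z : ℂ} (hz : ‖z‖ = 1) : ((1 - z) / (1 + z)).re = 0 := by
  have h : z.re * z.re + z.im * z.im = 1 := by
    rw [← Complex.normSq_apply, Complex.normSq_eq_norm_sq, hz, one_pow]
  rw [Complex.div_re, ← add_div]
  simp only [Complex.sub_re, Complex.add_re, Complex.one_re, Complex.sub_im, Complex.add_im,
    Complex.one_im]
  rw [show (1 - z.re) * (1 + z.re) + (0 - z.im) * (0 + z.im) = 0 by linarith, zero_div]

/-- An eigenvector `b` of `W` with eigenvalue `μ` satisfies `μ (X + Y) b = (X - Y) b`. So `s` is the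
Cayley transform `(1 - μ) / (1 + μ)`, imaginary because `‖μ‖ = 1`; the exception `μ = -1` gives `X b
= 0`. -/
theorem Matrix.exists_orthonormalBasis_of_mul_conjTranspose_add_eq_zero {n ι : Type*} [Fintype n]
    [Fintype ι] [DecidableEq n] [DecidableEq ι] (X Y : Matrix n ι ℂ) (h : X * Yᴴ + Y * Xᴴ = 0) :
    ∃ b : OrthonormalBasis (Fin (Module.finrank ℂ (EuclideanSpace ℂ ι))) ℂ (EuclideanSpace ℂ ι),
      ∀ i, X *ᵥ (b i).ofLp = 0 ∨
        ∃ s : ℂ, s.re = 0 ∧ Y *ᵥ (b i).ofLp = s • (X *ᵥ (b i).ofLp) := by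
  have hinner : ∀ (M : Matrix n ι ℂ) (v : EuclideanSpace ℂ n) (w : EuclideanSpace ℂ ι),
      inner ℂ (Mᴴ.toEuclideanLin v) w = inner ℂ v (M.toEuclideanLin w) := by
    intro M v w
    rw [Matrix.toEuclideanLin_conjTranspose_eq_adjoint, LinearMap.adjoint_inner_left]
  have hnorm : ∀ v, ‖(X + Y)ᴴ.toEuclideanLin v‖ = ‖(X - Y)ᴴ.toEuclideanLin v‖ := by
    intro v
    have hm : (X + Y) * (X + Y)ᴴ = (X - Y) * (X - Y)ᴴ := by
      rw [← sub_eq_zero]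
      simp only [Matrix.conjTranspose_add, Matrix.conjTranspose_sub]
      have h2 : (X + Y) * (Xᴴ + Yᴴ) - (X - Y) * (Xᴴ - Yᴴ) =
          (X * Yᴴ + Y * Xᴴ) + (X * Yᴴ + Y * Xᴴ) := by
        rw [Matrix.add_mul, Matrix.mul_add, Matrix.mul_add, Matrix.sub_mul, Matrix.mul_sub,
          Matrix.mul_sub]
        abel
      rw [h2, h, add_zero]
    have key : ∀ M : Matrix n ι ℂ, ((‖Mᴴ.toEuclideanLin v‖ : ℂ)) ^ 2 =
        inner ℂ v ((M * Mᴴ).toEuclideanLin v) := by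
      intro M
      have := inner_self_eq_norm_sq_to_K (𝕜 := ℂ) (Mᴴ.toEuclideanLin v)
      rw [hinner] at this
      rw [← Complex.coe_algebraMap]
      refine this.symm.trans ?_
      congr 1
      simp [Matrix.toLpLin_apply, Matrix.mulVec_mulVec]
    have h2 := (key (X + Y)).trans ((congrArg (fun M : Matrix n n ℂ =>
      inner ℂ v (M.toEuclideanLin v)) hm).trans (key (X - Y)).symm)
    have h3 : ‖(X + Y)ᴴ.toEuclideanLin v‖ ^ 2 = ‖(X - Y)ᴴ.toEuclideanLin v‖ ^ 2 := by
      exact_mod_cast h2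
    exact (sq_eq_sq₀ (norm_nonneg _) (norm_nonneg _)).1 h3
  obtain ⟨W, hW⟩ := LinearMap.exists_linearIsometry_comp_eq _ _ hnorm
  obtain ⟨b, μ, hb⟩ := W.exists_orthonormalBasis_eigenvectors
  refine ⟨b, fun i => ?_⟩
  have hb0 : b i ≠ 0 := b.orthonormal.ne_zero i
  have hμ := W.norm_eigenvalue hb0 (hb i)
  have hμ0 : μ i ≠ 0 := by rw [← norm_ne_zero_iff, hμ]; exact one_ne_zero
  have hX : μ i • (X + Y).toEuclideanLin (b i) = (X - Y).toEuclideanLin (b i) := by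
    refine ext_inner_left ℂ fun v => ?_
    rw [inner_smul_right, ← hinner, ← hinner, ← hW, ← inner_smul_right, ← hb, W.inner_map_map]
  have hX' : μ i • (X *ᵥ (b i).ofLp + Y *ᵥ (b i).ofLp) =
      X *ᵥ (b i).ofLp - Y *ᵥ (b i).ofLp := by
    have := congrArg WithLp.ofLp hX
    simpa [Matrix.toLpLin_apply, Matrix.add_mulVec, Matrix.sub_mulVec] using this
  have hXY : (1 + μ i) • (Y *ᵥ (b i).ofLp) = (1 - μ i) • (X *ᵥ (b i).ofLp) := by
    rw [smul_add] at hX'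
    rw [add_smul, sub_smul, one_smul, one_smul]
    linear_combination (exp := 1) hX'
  by_cases hz : 1 + μ i = 0
  · left
    have h2 : (1 - μ i) ≠ 0 := by
      intro h1
      have : (1 : ℂ) + 1 = 0 := by linear_combination hz + h1
      norm_num at this
    rw [hz, zero_smul] at hXY
    exact (smul_eq_zero.1 hXY.symm).resolve_left h2
  · right
    refine ⟨(1 - μ i) / (1 + μ i), Complex.re_sub_one_div_add_one hμ, ?_⟩
    rw [div_eq_inv_mul, mul_smul, ← hXY, smul_smul, inv_mul_cancel₀ hz, one_smul]

theorem Matrix.sum_star_dotProduct_mulVec_orthonormalBasis {ι κ : Type*} [Fintype ι]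
    [DecidableEq ι] [Fintype κ] (M : Matrix ι ι ℂ)
    (b : OrthonormalBasis κ ℂ (EuclideanSpace ℂ ι)) :
    ∑ i, star (b i).ofLp ⬝ᵥ (M *ᵥ (b i).ofLp) = M.trace := by
  have h := LinearMap.trace_eq_sum_inner M.toEuclideanLin b
  have h2 : LinearMap.trace ℂ _ M.toEuclideanLin = M.trace := by
    rw [show M.toEuclideanLin = Matrix.toLin (PiLp.basisFun 2 ℂ ι) (PiLp.basisFun 2 ℂ ι) M from
      congrArg (fun e => e M) (Matrix.toLpLin_eq_toLin 2 2)]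
    exact Matrix.trace_toLin_eq M _
  rw [← h2, h]
  refine Finset.sum_congr rfl fun i _ => ?_
  rw [EuclideanSpace.inner_eq_star_dotProduct, dotProduct_comm]
  rfl

/-! ### Closed cones, separation and positive functionals. -/

section
open scoped ComplexOrder MatrixOrder

theorem Complex.eq_zero_of_forall_nonneg_add_mul_re {a : ℝ} {b : ℂ}
    (h : ∀ c : ℂ, 0 ≤ a + (c * b).re) : b = 0 := by
  by_contra hb
  have hb' : 0 < Complex.normSq b := Complex.normSq_pos.2 hb
  have h1 := h (((-(|a| + 1) / Complex.normSq b : ℝ) : ℂ) * (starRingEnd ℂ) b)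
  rw [mul_assoc, ← Complex.normSq_eq_conj_mul_self, ← Complex.ofReal_mul, Complex.ofReal_re,
    div_mul_cancel₀ _ hb'.ne'] at h1
  linarith [le_abs_self a]

/-- Compactness of the unit sphere gives `δ ‖g‖ ≤ ‖g.1‖` on `G`, so preimages of a convergent
sequence are bounded and subconverge. -/
theorem isClosed_fst_image_of_closed_cone {E F : Type*} [NormedAddCommGroup E] [NormedSpace ℝ E]
    [FiniteDimensional ℝ E] [NormedAddCommGroup F] [NormedSpace ℝ F] [FiniteDimensional ℝ F]
    {G : Set (E × F)} (hG : IsClosed G) (hsmul : ∀ c : ℝ, 0 < c → ∀ g ∈ G, c • g ∈ G)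
    (hzero : ∀ p, ((0 : E), p) ∈ G → p = 0) : IsClosed (Prod.fst '' G) := by
  have : ProperSpace (E × F) := FiniteDimensional.proper ℝ _
  obtain ⟨δ, hδ, hδG⟩ : ∃ δ : ℝ, 0 < δ ∧ ∀ g ∈ G, δ * ‖g‖ ≤ ‖g.1‖ := by
    have hT : IsCompact (G ∩ Metric.sphere 0 1) := (isCompact_sphere _ _).inter_left hG
    obtain ⟨δ, hδ, h⟩ := hT.exists_forall_le' (f := fun g => ‖g.1‖) (a := 0)
      (by fun_prop) (by
        rintro ⟨x, p⟩ ⟨hg, hn⟩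
        refine norm_pos_iff.2 fun hx => ?_
        obtain rfl : x = 0 := hx
        obtain rfl := hzero p hg
        simp at hn)
    refine ⟨δ, hδ, fun g hg => ?_⟩
    rcases eq_or_ne g 0 with rfl | hg0
    · simp
    have hpos := norm_pos_iff.2 hg0
    have h1 := h (‖g‖⁻¹ • g) ⟨hsmul _ (inv_pos.2 hpos) g hg, by
      rw [mem_sphere_zero_iff_norm, norm_smul, norm_inv, norm_norm, inv_mul_cancel₀ hpos.ne']⟩
    simp only [Prod.smul_fst, norm_smul, norm_inv, norm_norm] at h1
    rwa [inv_mul_eq_div, le_div_iff₀ hpos] at h1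
  refine IsSeqClosed.isClosed fun x a hx ha => ?_
  choose g hgG hgx using hx
  obtain ⟨R, hR⟩ := ha.norm.bddAbove_range
  have hbdd : ∀ k, g k ∈ Metric.closedBall (0 : E × F) (R / δ) := by
    intro k
    rw [mem_closedBall_zero_iff, le_div_iff₀ hδ, mul_comm]
    refine (hδG _ (hgG k)).trans ?_
    rw [hgx]
    exact hR ⟨k, rfl⟩
  obtain ⟨b, -, φ, hφ, hb⟩ := tendsto_subseq_of_bounded Metric.isBounded_closedBall hbdd
  refine ⟨b, hG.mem_of_tendsto hb (Filter.Eventually.of_forall fun k => hgG _), ?_⟩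
  refine tendsto_nhds_unique ((continuous_fst.tendsto b).comp hb) ?_
  have : Prod.fst ∘ g ∘ φ = x ∘ φ := funext fun k => hgx _
  rw [this]
  exact ha.comp hφ.tendsto_atTop

theorem exists_nonneg_on_fst_image_of_closed_cone {E F : Type*} [NormedAddCommGroup E]
    [NormedSpace ℝ E] [FiniteDimensional ℝ E] [NormedAddCommGroup F] [NormedSpace ℝ F]
    [FiniteDimensional ℝ F] {G : Set (E × F)} (hG : IsClosed G) (h0 : (0 : E × F) ∈ G)
    (hadd : ∀ g ∈ G, ∀ g' ∈ G, g + g' ∈ G)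
    (hsmul : ∀ c : ℝ, 0 < c → ∀ g ∈ G, c • g ∈ G)
    (hzero : ∀ p, ((0 : E), p) ∈ G → p = 0) {q : E} (hq : ∀ p, (q, p) ∉ G) :
    ∃ f : E →L[ℝ] ℝ, (∀ g ∈ G, 0 ≤ f g.1) ∧ f q < 0 := by
  have hconv : Convex ℝ (Prod.fst '' G) := by
    refine Convex.is_linear_image ?_ (LinearMap.fst ℝ E F).isLinear
    refine convex_iff_forall_pos.2 fun g hg g' hg' a b ha hb _ => ?_
    exact hadd _ (hsmul a ha g hg) _ (hsmul b hb g' hg')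
  obtain ⟨f, u, hfq, hf⟩ := geometric_hahn_banach_point_closed hconv
    (isClosed_fst_image_of_closed_cone hG hsmul hzero) (x := q)
    (by rintro ⟨⟨q', p⟩, hg, rfl⟩; exact hq p hg)
  have hu : u < 0 := by simpa using hf 0 ⟨0, h0, rfl⟩
  refine ⟨f, fun g hg => ?_, hfq.trans hu⟩
  by_contra! hneg
  -- This rescaling makes `f` equal to `u`, against the strict separation.
  have h1 := hf _ ⟨_, hsmul (u / f g.1) (div_pos_of_neg_of_neg hu hneg) g hg, rfl⟩
  rw [Prod.smul_fst, map_smul, smul_eq_mul, div_mul_cancel₀ _ hneg.ne] at h1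
  exact h1.false

theorem Matrix.eq_re_trace_mul_of_linearMap {ι : Type*} [Fintype ι] [DecidableEq ι]
    (f : Matrix ι ι ℂ →ₗ[ℝ] ℝ) (M : Matrix ι ι ℂ) :
    f M = (M * Matrix.of fun i j => ((f (Matrix.single j i 1) : ℂ) -
      Complex.I * f (Matrix.single j i Complex.I))).trace.re := by
  have h : ∀ (i j : ι) (c : ℂ), f (Matrix.single i j c) =
      (c * ((f (Matrix.single i j 1) : ℂ) - Complex.I * f (Matrix.single i j Complex.I))).re := by
    intro i j c
    have hc : Matrix.single i j c =
        c.re • Matrix.single i j (1 : ℂ) + c.im • Matrix.single i j Complex.I := by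
      rw [Matrix.smul_single, Matrix.smul_single, ← Matrix.single_add]
      congr 1
      apply Complex.ext <;> simp
    rw [hc, map_add, map_smul, map_smul]
    simp
  conv_lhs => rw [Matrix.matrix_eq_sum_single M]
  simp only [map_sum, Matrix.trace, Matrix.diag, Matrix.mul_apply, Complex.re_sum]
  exact Finset.sum_congr rfl fun i _ => Finset.sum_congr rfl fun j _ => h i j _

/-- The hypothesis sees only the real part of the form, so `f` kills every `Mᴴ - M` and its trace
density `Z` is Hermitian. Rank-one matrices `v v'` show `Z ≥ 0`, and `T` comes from a square
factorization of `Z`. -/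
theorem Matrix.exists_eq_re_trace_conjTranspose_mul_mul {ι : Type*} [Fintype ι] [DecidableEq ι]
    (f : Matrix ι ι ℂ →ₗ[ℝ] ℝ)
    (hf : ∀ M : Matrix ι ι ℂ, (∀ v, 0 ≤ (star v ⬝ᵥ (M *ᵥ v)).re) → 0 ≤ f M) :
    ∃ T : Matrix ι ι ℂ, ∀ M, f M = (Tᴴ * M * T).trace.re := by
  set Z : Matrix ι ι ℂ := Matrix.of fun i j => ((f (Matrix.single j i 1) : ℂ) -
      Complex.I * f (Matrix.single j i Complex.I)) with hZ
  have hfZ : ∀ M, f M = (M * Z).trace.re := Matrix.eq_re_trace_mul_of_linearMap f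
  have hstar : ∀ M : Matrix ι ι ℂ, f Mᴴ = f M := by
    intro M
    have hre : ∀ v, (star v ⬝ᵥ (Mᴴ *ᵥ v)).re = (star v ⬝ᵥ (M *ᵥ v)).re := by
      intro v
      rw [← Complex.conj_re (star v ⬝ᵥ (M *ᵥ v)), starRingEnd_apply, Matrix.star_dotProduct,
        Matrix.star_mulVec, Matrix.conjTranspose_conjTranspose, ← Matrix.dotProduct_mulVec]
    have h1 := hf (Mᴴ - M) fun v => by
      rw [Matrix.sub_mulVec, dotProduct_sub, Complex.sub_re, hre, sub_self]
    have h2 := hf (M - Mᴴ) fun v => by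
      rw [Matrix.sub_mulVec, dotProduct_sub, Complex.sub_re, hre, sub_self]
    rw [map_sub] at h1 h2
    linarith
  have hherm : Z.IsHermitian := by
    ext i j
    have h1 := hstar (Matrix.single i j 1)
    have h2 := hstar (Matrix.single i j Complex.I)
    rw [Matrix.conjTranspose_single] at h1 h2
    rw [star_one] at h1
    rw [show star Complex.I = -Complex.I from Complex.conj_I, ← Matrix.single_neg, map_neg] at h2
    rw [Matrix.conjTranspose_apply]
    simp only [hZ, Matrix.of_apply, h1, ← h2]
    simp [sub_eq_add_neg]
  have hpos : Z.PosSemidef := by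
    refine Matrix.PosSemidef.of_dotProduct_mulVec_nonneg hherm fun v => ?_
    have h1 := hf (Matrix.vecMulVec v (star v)) fun w =>
      (Complex.le_def.1 ((Matrix.posSemidef_vecMulVec_self_star v).dotProduct_mulVec_nonneg w)).1
    rw [hfZ, Matrix.vecMulVec_mul, Matrix.trace_vecMulVec, dotProduct_comm,
      ← Matrix.dotProduct_mulVec] at h1
    rw [Complex.le_def]
    exact ⟨h1, (hherm.im_star_dotProduct_mulVec_self v).symm⟩
  obtain ⟨S, hS⟩ := CStarAlgebra.nonneg_iff_eq_star_mul_self.1 hpos.nonneg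
  refine ⟨Sᴴ, fun M => ?_⟩
  rw [hfZ, hS, Matrix.star_eq_conjTranspose, Matrix.conjTranspose_conjTranspose, Matrix.mul_assoc, Matrix.trace_mul_comm S,
    Matrix.mul_assoc]

/-! ### Consequences of controllability, and `σ` at `s = ∞`. -/

namespace KYP

variable {n m : ℕ} {A : Matrix (Fin n) (Fin n) ℂ} {B : Matrix (Fin n) (Fin m) ℂ}

/-- A bounded-below affine function of `c` is constant; hence `P B = 0` and `ker P` is
`A`-invariant. Its orthogonal complement `N` is then `Aᴴ`-invariant and orthogonal to the range of
`B`. An eigenvector of `Aᴴ` in `N` would contradict right invertibility, so `N`, which contains the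
range of `P`, is zero. -/
theorem Controllable.eq_zero_of_forall_nonneg (hAB : Controllable A B)
    {P : Matrix (Fin n) (Fin n) ℂ} (hP : P.IsHermitian)
    (h : ∀ x u, 0 ≤ (star x ⬝ᵥ (P *ᵥ (A *ᵥ x + B *ᵥ u))).re) : P = 0 := by
  have hsymm : ∀ x y, star x ⬝ᵥ (P *ᵥ y) = star (P *ᵥ x) ⬝ᵥ y := by
    intro x y
    rw [Matrix.star_mulVec, hP.eq, Matrix.dotProduct_mulVec]
  have hPB : ∀ u, P *ᵥ (B *ᵥ u) = 0 := by
    refine fun u => dotProduct_star_self_eq_zero.1 ?_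
    set x := P *ᵥ (B *ᵥ u)
    refine Complex.eq_zero_of_forall_nonneg_add_mul_re
      (a := (star x ⬝ᵥ (P *ᵥ (A *ᵥ x))).re) fun c => ?_
    have := h x (c • u)
    rwa [Matrix.mulVec_add, dotProduct_add, Matrix.mulVec_smul, Matrix.mulVec_smul,
      dotProduct_smul, Complex.add_re, smul_eq_mul] at this
  have hPA : ∀ x, P *ᵥ x = 0 → P *ᵥ (A *ᵥ x) = 0 := by
    refine fun x hx => dotProduct_star_self_eq_zero.1 ?_
    set y := P *ᵥ (A *ᵥ x)
    refine Complex.eq_zero_of_forall_nonneg_add_mul_re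
      (a := (star y ⬝ᵥ (P *ᵥ (A *ᵥ y))).re) fun c => ?_
    have := h (y + c • x) 0
    rwa [Matrix.mulVec_zero, add_zero, hsymm, Matrix.mulVec_add, Matrix.mulVec_smul, hx, smul_zero,
      add_zero, ← hsymm, Matrix.mulVec_add, Matrix.mulVec_smul, Matrix.mulVec_add,
      Matrix.mulVec_smul, dotProduct_add, dotProduct_smul, Complex.add_re, smul_eq_mul] at this
  let N : Submodule ℂ (Fin n → ℂ) :=
    { carrier := {w | ∀ x, P *ᵥ x = 0 → star x ⬝ᵥ w = 0}
      zero_mem' := fun x _ => dotProduct_zero _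
      add_mem' := fun hv hw x hx => by rw [dotProduct_add, hv x hx, hw x hx, add_zero]
      smul_mem' := fun c w hw x hx => by rw [dotProduct_smul, hw x hx, smul_zero] }
  have hadj : ∀ x w, star x ⬝ᵥ (Aᴴ *ᵥ w) = star (A *ᵥ x) ⬝ᵥ w := by
    intro x w
    rw [Matrix.star_mulVec, Matrix.dotProduct_mulVec]
  have hN : ∀ w ∈ N, Aᴴ.mulVecLin w ∈ N := by
    intro w hw x hx
    rw [Matrix.mulVecLin_apply, hadj]
    exact hw _ (hPA x hx)
  have hbot : N = ⊥ := by
    by_contra hne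
    have : Nontrivial N := Submodule.nontrivial_iff_ne_bot.2 hne
    obtain ⟨l, hl⟩ := Module.End.exists_eigenvalue (Aᴴ.mulVecLin.restrict hN)
    obtain ⟨⟨w, hw⟩, hlw, hw0⟩ := hl.exists_hasEigenvector
    rw [Module.End.mem_eigenspace_iff] at hlw
    have hlw' : Aᴴ *ᵥ w = l • w := congrArg Subtype.val hlw
    obtain ⟨R, hR⟩ := hAB (star l)
    have hwA : star w ᵥ* A = star l • star w := by
      rw [← star_smul, ← hlw', Matrix.star_mulVec, Matrix.conjTranspose_conjTranspose]
    have hwB : star w ᵥ* B = 0 := by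
      refine dotProduct_eq_zero _ fun u => ?_
      rw [← Matrix.dotProduct_mulVec, ← star_star (B *ᵥ u), Matrix.star_dotProduct_star,
        hw _ (hPB u), star_zero]
    have h0 : star w ᵥ* Matrix.fromCols (star l • (1 : Matrix (Fin n) (Fin n) ℂ) - A) B = 0 := by
      rw [Matrix.vecMul_fromCols, hwB, Matrix.vecMul_sub, Matrix.vecMul_smul, Matrix.vecMul_one,
        hwA, sub_self]
      ext (i | i) <;> rfl
    have h1 : star w = 0 := by
      rw [← Matrix.vecMul_one (star w), ← hR, ← Matrix.vecMul_vecMul, h0, Matrix.zero_vecMul]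
    exact hw0 (Subtype.ext (star_eq_zero.1 h1))
  refine Matrix.ext_of_mulVec_single fun i => ?_
  have hmem : P *ᵥ Pi.single i 1 ∈ N := by
    intro x hx
    rw [hsymm, hx, star_zero, zero_dotProduct]
  rw [hbot, Submodule.mem_bot] at hmem
  rw [hmem, Matrix.zero_mulVec]

theorem continuous_sigma (Q : Matrix (Fin n ⊕ Fin m) (Fin n ⊕ Fin m) ℂ) :
    Continuous (sigma Q) := by
  unfold sigma
  have h : Continuous fun v : (Fin n → ℂ) × (Fin m → ℂ) => Sum.elim v.1 v.2 := by
    refine continuous_pi ?_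
    rintro (i | i)
    · exact (continuous_apply i).comp continuous_fst
    · exact (continuous_apply i).comp continuous_snd
  exact Complex.continuous_re.comp (h.star.dotProduct (continuous_const.matrix_mulVec h))

theorem sigma_zero_nonneg {Q : Matrix (Fin n ⊕ Fin m) (Fin n ⊕ Fin m) ℂ}
    (hb : ∀ s : ℂ, s.re = 0 → PosSemidefOn (sigma Q) (L A B s)) (u : Fin m → ℂ) :
    0 ≤ sigma Q (0, u) := by
  -- `I ^ n` is `det (N 0)`. Along `s = I / t`, the adjugate gives a point of `L(s)` without
  -- inverting `N t`, and this point tends to `(0, u)` as `t → 0`.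
  obtain ⟨u', hu'⟩ : ∃ u', Complex.I ^ n • u' = u :=
    ⟨(Complex.I ^ n)⁻¹ • u, smul_inv_smul₀ (pow_ne_zero n Complex.I_ne_zero) u⟩
  let N : ℝ → Matrix (Fin n) (Fin n) ℂ := fun t =>
    Complex.I • (1 : Matrix (Fin n) (Fin n) ℂ) - (t : ℂ) • A
  let v : ℝ → (Fin n → ℂ) × (Fin m → ℂ) := fun t =>
    ((t : ℂ) • ((N t).adjugate *ᵥ (B *ᵥ u')), (N t).det • u')
  have hNc : Continuous N := by fun_prop
  have hvc : Continuous v :=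
    (Complex.continuous_ofReal.smul (hNc.matrix_adjugate.matrix_mulVec continuous_const)).prodMk
      (hNc.matrix_det.smul continuous_const)
  have hv0 : v 0 = (0, u) := by
    simp [v, N, hu']
  have hv : ∀ t : ℝ, t ≠ 0 → v t ∈ L A B (Complex.I / t) := by
    intro t ht
    have ht' : (t : ℂ) ≠ 0 := Complex.ofReal_ne_zero.2 ht
    have h1 : N t *ᵥ (v t).1 = (t : ℂ) • (B *ᵥ (v t).2) := by
      simp only [v]
      rw [Matrix.mulVec_smul, Matrix.mulVec_mulVec, Matrix.mul_adjugate, Matrix.smul_mulVec,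
        Matrix.one_mulVec, Matrix.mulVec_smul B]
    simp only [N] at h1
    rw [Matrix.sub_mulVec, Matrix.smul_mulVec, Matrix.smul_mulVec, Matrix.one_mulVec,
      sub_eq_iff_eq_add, ← smul_add] at h1
    change (Complex.I / t) • (v t).1 = A *ᵥ (v t).1 + B *ᵥ (v t).2
    rw [div_eq_inv_mul, mul_smul, h1, smul_smul, inv_mul_cancel₀ ht', one_smul, add_comm]
  rw [← hv0]
  have ht : Filter.Tendsto (fun t => sigma Q (v t)) (nhdsWithin 0 {0}ᶜ) (nhds (sigma Q (v 0))) :=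
    (((continuous_sigma Q).comp hvc).tendsto 0).mono_left nhdsWithin_le_nhds
  refine ge_of_tendsto ht ?_
  filter_upwards [self_mem_nhdsWithin] with t ht
  exact hb _ (by simp) _ (hv t ht)

end KYP
end

/-! ### Evaluation of `σ` on factored data. -/

namespace KYP

section

variable {n m : ℕ} {A : Matrix (Fin n) (Fin n) ℂ} {B : Matrix (Fin n) (Fin m) ℂ}
  {Q : Matrix (Fin n ⊕ Fin m) (Fin n ⊕ Fin m) ℂ} {P : Matrix (Fin n) (Fin n) ℂ}

theorem sigma_eq_sigmaP_of_mem_L (hP : P.IsHermitian) {s : ℂ} (hs : s.re = 0)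
    {v : (Fin n → ℂ) × (Fin m → ℂ)} (hv : v ∈ L A B s) : sigma Q v = sigmaP A B Q P v := by
  have hv' : s • v.1 = A *ᵥ v.1 + B *ᵥ v.2 := hv
  have him : (star v.1 ⬝ᵥ (P *ᵥ v.1)).im = 0 := hP.im_star_dotProduct_mulVec_self v.1
  rw [sigmaP, ← hv', Matrix.mulVec_smul, dotProduct_smul, smul_eq_mul, Complex.mul_re, hs, him]
  ring

theorem sum_sigma_nonneg (hb : ∀ s : ℂ, s.re = 0 → PosSemidefOn (sigma Q) (L A B s))
    {ι : Type*} [Fintype ι] [DecidableEq ι] (X : Matrix (Fin n) ι ℂ) (U : Matrix (Fin m) ι ℂ)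
    (h : X * (A * X + B * U)ᴴ + (A * X + B * U) * Xᴴ = 0) :
    0 ≤ ((Matrix.fromRows X U)ᴴ * Q * Matrix.fromRows X U).trace.re := by
  obtain ⟨b, hbX⟩ := Matrix.exists_orthonormalBasis_of_mul_conjTranspose_add_eq_zero X _ h
  rw [← Matrix.sum_star_dotProduct_mulVec_orthonormalBasis _ b, Complex.re_sum]
  refine Finset.sum_nonneg fun i _ => ?_
  have hσ : (star (b i).ofLp ⬝ᵥ
      (((Matrix.fromRows X U)ᴴ * Q * Matrix.fromRows X U) *ᵥ (b i).ofLp)).re =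
      sigma Q (X *ᵥ (b i).ofLp, U *ᵥ (b i).ofLp) := by
    rw [sigma, ← Matrix.fromRows_mulVec, Matrix.star_mulVec, ← Matrix.dotProduct_mulVec,
      Matrix.mulVec_mulVec, Matrix.mulVec_mulVec]
  rw [hσ]
  rcases hbX i with h0 | ⟨s, hs, hsX⟩
  · rw [h0]
    exact sigma_zero_nonneg hb _
  · refine hb s hs _ ?_
    rw [Matrix.add_mulVec, ← Matrix.mulVec_mulVec, ← Matrix.mulVec_mulVec] at hsX
    exact hsX.symm

theorem star_elim_dotProduct_certificate (A : Matrix (Fin n) (Fin n) ℂ)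
    (B : Matrix (Fin n) (Fin m) ℂ) (P : Matrix (Fin n) (Fin n) ℂ)
    (v : Fin n ⊕ Fin m → ℂ) :
    star v ⬝ᵥ ((Matrix.fromRows (1 : Matrix (Fin n) (Fin n) ℂ) (0 : Matrix (Fin m) (Fin n) ℂ) *
      P * Matrix.fromCols A B) *ᵥ v) =
    star (v ∘ Sum.inl) ⬝ᵥ (P *ᵥ (A *ᵥ (v ∘ Sum.inl) + B *ᵥ (v ∘ Sum.inr))) := by
  rw [← Matrix.mulVec_mulVec, ← Matrix.mulVec_mulVec, Matrix.fromRows_mulVec,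
    Matrix.fromCols_mulVec, Matrix.one_mulVec, Matrix.zero_mulVec]
  simp [dotProduct]

end

/-! ### The separation argument. -/

section

open scoped ComplexOrder

attribute [local instance] Matrix.normedAddCommGroup Matrix.normedSpace

variable {n m : ℕ} {A : Matrix (Fin n) (Fin n) ℂ} {B : Matrix (Fin n) (Fin m) ℂ}
  {Q : Matrix (Fin n ⊕ Fin m) (Fin n ⊕ Fin m) ℂ} {P : Matrix (Fin n) (Fin n) ℂ}

theorem Controllable.exists_sigmaP_nonneg (hAB : Controllable A B)
    (hb : ∀ s : ℂ, s.re = 0 → PosSemidefOn (sigma Q) (L A B s)) :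
    ∃ P : Matrix (Fin n) (Fin n) ℂ, P.IsHermitian ∧ PosSemidefOn (sigmaP A B Q P) ⊤ := by
  by_contra! hcon
  let C : Matrix (Fin n) (Fin n) ℂ → Matrix (Fin n ⊕ Fin m) (Fin n ⊕ Fin m) ℂ := fun P =>
    Matrix.fromRows (1 : Matrix (Fin n) (Fin n) ℂ) (0 : Matrix (Fin m) (Fin n) ℂ) * P *
      Matrix.fromCols A B
  let φ : Matrix (Fin n ⊕ Fin m) (Fin n ⊕ Fin m) ℂ × Matrix (Fin n) (Fin n) ℂ →
      (Fin n ⊕ Fin m → ℂ) → ℝ := fun g v =>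
    (star v ⬝ᵥ (g.1 *ᵥ v)).re + 2 * (star v ⬝ᵥ (C g.2 *ᵥ v)).re
  let G : Set (Matrix (Fin n ⊕ Fin m) (Fin n ⊕ Fin m) ℂ × Matrix (Fin n) (Fin n) ℂ) :=
    {g | g.2ᴴ = g.2 ∧ ∀ v, 0 ≤ φ g v}
  have hφ_add : ∀ g g' v, φ (g + g') v = φ g v + φ g' v := by
    intro g g' v
    simp only [φ, C, Prod.fst_add, Prod.snd_add, Matrix.mul_add, Matrix.add_mul,
      Matrix.add_mulVec, dotProduct_add, Complex.add_re]
    ring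
  have hφ_smul : ∀ (c : ℝ) g v, φ (c • g) v = c * φ g v := by
    intro c g v
    simp only [φ, C, Prod.smul_fst, Prod.smul_snd, Matrix.mul_smul, Matrix.smul_mul,
      Matrix.smul_mulVec, dotProduct_smul, Complex.smul_re, smul_eq_mul]
    ring
  have hclosed : IsClosed G := by
    have h1 : IsClosed {g : Matrix (Fin n ⊕ Fin m) (Fin n ⊕ Fin m) ℂ × Matrix (Fin n) (Fin n) ℂ |
        g.2ᴴ = g.2} := isClosed_eq (by fun_prop) (by fun_prop)
    have h2 : ∀ v, IsClosed {g | 0 ≤ φ g v} := by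
      refine fun v => isClosed_le continuous_const ?_
      simp only [φ, C]
      fun_prop
    have hG : G = {g | g.2ᴴ = g.2} ∩ ⋂ v, {g | 0 ≤ φ g v} := by
      ext g
      simp [G]
    rw [hG]
    exact h1.inter (isClosed_iInter h2)
  have hmem_zero : ∀ M : Matrix (Fin n ⊕ Fin m) (Fin n ⊕ Fin m) ℂ,
      (∀ v, 0 ≤ (star v ⬝ᵥ (M *ᵥ v)).re) → (M, 0) ∈ G := by
    intro M hM
    refine ⟨Matrix.conjTranspose_zero, fun v => ?_⟩
    simpa [φ, C] using hM v
  have hform : ∀ (M : Matrix (Fin n ⊕ Fin m) (Fin n ⊕ Fin m) ℂ) P x u,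
      φ (M, P) (Sum.elim x u) = sigmaP A B M P (x, u) := by
    intro M P x u
    simp only [φ, C, sigmaP, sigma]
    rw [star_elim_dotProduct_certificate, Sum.elim_comp_inl, Sum.elim_comp_inr]
  obtain ⟨f, hf, hfQ⟩ := exists_nonneg_on_fst_image_of_closed_cone (G := G) (q := Q) hclosed
    (hmem_zero 0 (by simp))
    (fun g hg g' hg' => ⟨by rw [Prod.snd_add, Matrix.conjTranspose_add, hg.1, hg'.1], fun v => by
      rw [hφ_add]; exact add_nonneg (hg.2 v) (hg'.2 v)⟩)
    (fun c hc g hg => ⟨by rw [Prod.smul_snd, Matrix.conjTranspose_smul, hg.1, star_trivial],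
      fun v => by rw [hφ_smul]; exact mul_nonneg hc.le (hg.2 v)⟩)
    (fun P hP => hAB.eq_zero_of_forall_nonneg hP.1 fun x u => by
      have := hP.2 (Sum.elim x u)
      rw [hform] at this
      simpa [sigmaP, sigma] using this)
    (fun P hP => hcon P hP.1 fun v _ => by
      have := hP.2 (Sum.elim v.1 v.2)
      rwa [hform] at this)
  obtain ⟨T, hT⟩ := Matrix.exists_eq_re_trace_conjTranspose_mul_mul f.toLinearMap
    fun M hM => hf _ (hmem_zero M hM)
  have hT' : ∀ M, f M = (Tᴴ * M * T).trace.re := hT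
  have hfC : ∀ P : Matrix (Fin n) (Fin n) ℂ, P.IsHermitian → f (C P) = 0 := by
    have hmem : ∀ (c : ℝ) (P : Matrix (Fin n) (Fin n) ℂ), P.IsHermitian → 0 ≤ c * f (C P) := by
      intro c P hP
      -- The factor `-(c / 2)` cancels the `2` in `σ_P`, so `φ` is zero here for both signs of `c`.
      have h1 : (c • C P, (-(c / 2)) • P) ∈ G := by
        refine ⟨by rw [Matrix.conjTranspose_smul, hP.eq, star_trivial], fun v => le_of_eq ?_⟩
        simp only [φ, C, Matrix.mul_smul, Matrix.smul_mul, Matrix.smul_mulVec, dotProduct_smul,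
          Complex.smul_re, smul_eq_mul]
        ring
      simpa using hf _ h1
    intro P hP
    have h1 := hmem 1 P hP
    have h2 := hmem (-1) P hP
    linarith
  obtain ⟨X, U, rfl⟩ : ∃ X U, T = Matrix.fromRows X U :=
    ⟨T.toRows₁, T.toRows₂, (Matrix.fromRows_toRows T).symm⟩
  set Y := A * X + B * U with hY
  have hCT : ∀ P : Matrix (Fin n) (Fin n) ℂ, f (C P) = (P * (Y * Xᴴ)).trace.re := by
    intro P
    have h1 : (Matrix.fromRows X U)ᴴ *
        Matrix.fromRows (1 : Matrix (Fin n) (Fin n) ℂ) (0 : Matrix (Fin m) (Fin n) ℂ) = Xᴴ := by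
      rw [Matrix.conjTranspose_fromRows_eq_fromCols_conjTranspose, Matrix.fromCols_mul_fromRows,
        Matrix.mul_one, Matrix.mul_zero, add_zero]
    have h2 : Matrix.fromCols A B * Matrix.fromRows X U = Y := Matrix.fromCols_mul_fromRows ..
    rw [hT', ← Matrix.mul_assoc, ← Matrix.mul_assoc, h1, Matrix.mul_assoc, h2, Matrix.mul_assoc,
      Matrix.trace_mul_comm, Matrix.mul_assoc]
  have hD : X * Yᴴ + Y * Xᴴ = 0 := by
    have hDh : (X * Yᴴ + Y * Xᴴ).IsHermitian := by
      rw [Matrix.IsHermitian, Matrix.conjTranspose_add, Matrix.conjTranspose_mul,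
        Matrix.conjTranspose_mul, Matrix.conjTranspose_conjTranspose,
        Matrix.conjTranspose_conjTranspose, add_comm]
    set D := X * Yᴴ + Y * Xᴴ with hD
    -- Testing `f ∘ C` on `D` itself yields `Re tr (D' D) = 0`, hence `D = 0`.
    have h1 : (D * (Y * Xᴴ)).trace.re = 0 := by rw [← hCT, hfC D hDh]
    have h2 : (D * (X * Yᴴ)).trace.re = 0 := by
      rw [← h1, ← Complex.conj_re (D * (Y * Xᴴ)).trace, starRingEnd_apply,
        ← Matrix.trace_conjTranspose, Matrix.conjTranspose_mul, Matrix.conjTranspose_mul,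
        Matrix.conjTranspose_conjTranspose, hDh.eq, Matrix.trace_mul_comm]
    have h3 : (Dᴴ * D).trace.re = 0 := by
      rw [hDh.eq]
      nth_rw 2 [hD]
      rw [Matrix.mul_add, Matrix.trace_add, Complex.add_re, h1, h2, add_zero]
    refine Matrix.trace_conjTranspose_mul_self_eq_zero_iff.1 (Complex.ext h3 ?_)
    exact (Complex.le_def.1 (Matrix.posSemidef_conjTranspose_mul_self D).trace_nonneg).2.symm
  have := sum_sigma_nonneg hb X U hD
  rw [← hT'] at this
  exact absurd hfQ (not_lt.2 this)

end

/-! ### Real data. -/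

section

variable {n m : ℕ} {A : Matrix (Fin n) (Fin n) ℂ} {B : Matrix (Fin n) (Fin m) ℂ}
  {Q : Matrix (Fin n ⊕ Fin m) (Fin n ⊕ Fin m) ℂ} {P : Matrix (Fin n) (Fin n) ℂ}

theorem IsRealMatrix.map_star {p q : Type*} {M : Matrix p q ℂ} (hM : IsRealMatrix M) :
    M.map star = M := by
  ext i j
  exact Complex.conj_eq_iff_im.2 (hM i j)

theorem sigmaP_map_star (hA : IsRealMatrix A) (hB : IsRealMatrix B) (hQ : IsRealMatrix Q)
    (v : (Fin n → ℂ) × (Fin m → ℂ)) :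
    sigmaP A B Q (P.map star) v = sigmaP A B Q P (star v) := by
  have hmul : ∀ {p q : Type} [Fintype q] (M : Matrix p q ℂ) (x : q → ℂ),
      star (M *ᵥ x) = M.map star *ᵥ star x := by
    intro p q _ M x
    ext i
    simp [Matrix.mulVec, dotProduct]
  have hdot : ∀ {p : Type} [Fintype p] (x y : p → ℂ), (star x ⬝ᵥ star y).re = (x ⬝ᵥ y).re := by
    intro p _ x y
    rw [Matrix.star_dotProduct_star, dotProduct_comm]
    exact Complex.conj_re _
  have helim : Sum.elim (star v).1 (star v).2 = star (Sum.elim v.1 v.2) := by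
    ext (i | i) <;> rfl
  have hPP : (P.map star).map star = P := by
    ext i j
    simp
  unfold sigmaP sigma
  rw [helim, ← hdot (star (Sum.elim v.1 v.2)), hmul Q, hQ.map_star,
    ← hdot (star v.1), hmul (P.map star), star_add, hmul A, hmul B, hA.map_star, hB.map_star, hPP]
  rfl

/-- With real data the entrywise conjugate of `P` also works, by conjugating the argument. As `σ_P`
is affine in `P`, so does the average of the two. -/
theorem exists_isRealMatrix_sigmaP_nonneg (hA : IsRealMatrix A) (hB : IsRealMatrix B)
    (hQ : IsRealMatrix Q) (hP : P.IsHermitian) (h : PosSemidefOn (sigmaP A B Q P) ⊤) :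
    ∃ P : Matrix (Fin n) (Fin n) ℂ, P.IsHermitian ∧ IsRealMatrix P ∧
      PosSemidefOn (sigmaP A B Q P) ⊤ := by
  refine ⟨(1 / 2 : ℝ) • (P + P.map star), ?_, fun i j => ?_, fun v _ => ?_⟩
  · have hs : (P.map star)ᴴ = P.map star := by
      rw [← Matrix.conjTranspose_map star (fun _ => rfl), hP.eq]
    rw [Matrix.IsHermitian, Matrix.conjTranspose_smul, Matrix.conjTranspose_add, hP.eq, hs,
      star_trivial]
  · simp
  · have h1 := h v trivial
    have h2 := h (star v) trivial
    rw [← sigmaP_map_star hA hB hQ] at h2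
    unfold sigmaP at h1 h2 ⊢
    rw [Matrix.smul_mulVec, Matrix.add_mulVec, dotProduct_smul, dotProduct_add, Complex.smul_re,
      Complex.add_re, smul_eq_mul]
    linarith

end

end KYP

theorem mainTheorem8 {n m : ℕ} (A : Matrix (Fin n) (Fin n) ℂ) (B : Matrix (Fin n) (Fin m) ℂ)
    (hAB : KYP.Controllable A B)
    (Q : Matrix (Fin n ⊕ Fin m) (Fin n ⊕ Fin m) ℂ) (hQ : Q.IsHermitian) :
    ((∃ P : Matrix (Fin n) (Fin n) ℂ, P.IsHermitian ∧
        KYP.PosSemidefOn (KYP.sigmaP A B Q P) ⊤) ↔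
      ∀ s : ℂ, s.re = 0 → KYP.PosSemidefOn (KYP.sigma Q) (KYP.L A B s)) ∧
    (KYP.IsRealMatrix A → KYP.IsRealMatrix B → KYP.IsRealMatrix Q →
      (∀ s : ℂ, s.re = 0 → KYP.PosSemidefOn (KYP.sigma Q) (KYP.L A B s)) →
      ∃ P : Matrix (Fin n) (Fin n) ℂ, P.IsHermitian ∧ KYP.IsRealMatrix P ∧
        KYP.PosSemidefOn (KYP.sigmaP A B Q P) ⊤) := by
  refine ⟨⟨?_, hAB.exists_sigmaP_nonneg⟩, fun hA hB hQr hb => ?_⟩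
  · rintro ⟨P, hP, h⟩ s hs v hv
    rw [KYP.sigma_eq_sigmaP_of_mem_L hP hs hv]
    exact h v trivial
  · obtain ⟨P, hP, h⟩ := hAB.exists_sigmaP_nonneg hb
    exact KYP.exists_isRealMatrix_sigmaP_nonneg hA hB hQr hP h
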